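/- **Proposition 2.** All norms are Frobenius (Euclidean) norms. A *mode tree* $\mathcal{T}$ over $[N]=\{1,\dots,N\}$ is a finite rooted tree in which every node is labeled by a subset of $[N]$, there are exactly $N$ leaves, labeled $\{1\},\dots,\{N\}$, and the label of each interior (non-leaf) node is the union of the labels of its children. Let $|\mathcal{T}|$ be the number of nodes, $\mathrm{int}(\mathcal{T})$ the set of interior nodes, $C(\nu)$ the set of children of $\nu$, and $Pa(\nu)$ the parent of a non-root node $\nu$; below, a node is also written for its label. Let $D_1,\dots,D_N$ and $(R_\nu)_{\nu\in\mathrm{int}(\mathcal{T})}$ be natural numbers; put $R_\nu:=D_n$ for the leaf $\nu$ labeled $\{n\}$, and $R_{Pa(\nu)}:=1$ for the root $\nu$. Let $W^{(\nu)}\in\mathbb{R}^{R_\nu\times R_{Pa(\nu)}}$, $\nu\in\mathcal{T}$, be weight matrices. For $r\in[R_{Pa(\nu)}]$ define tensors $\mathcal{W}^{(\nu,r)}$, with modes indexed by the label of $\nu$, from the leaves to the root by $\mathcal{W}^{(\nu,r)}:=W^{(\nu)}_{:,r}$ if $\nu$ is a leaf and $$\mathcal{W}^{(\nu,r)}:=\sum_{r'=1}^{R_\nu}W^{(\nu)}_{r',r}\,\bigotimes_{\nu_c\in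 C(\nu)}\mathcal{W}^{(\nu_c,r')}$$ if $\nu$ is interior (the modes of the tensor product being arranged in ascending order). The *end tensor* $\mathcal{W}_{\mathrm H}\in\mathbb{R}^{D_1,\dots,D_N}$ is $\mathcal{W}^{(\nu,1)}$ for the root $\nu$. For $\nu\in\mathrm{int}(\mathcal{T})$ and $r\in[R_\nu]$, the local component norm is $\sigma^{(\nu,r)}:=\big\|W^{(\nu)}_{r,:}\otimes\bigotimes_{\nu_c\in C(\nu)}W^{(\nu_c)}_{:,r}\big\|$. For $\mathcal{W}\in\mathbb{R}^{D_1,\dots,D_N}$ and $I\subseteq[N]$, $[\![\mathcal{W}]\!]_I$ is the matricization of $\mathcal{W}$ whose rows correspond to the modes in $I$ and whose columns correspond to the remaining modes. Let $B:=\max_{\nu\in\mathcal{T}}\|W^{(\nu)}\|$, let $\epsilon\ge 0$ and let $(R'_\nu)_{\nu\in\mathrm{int}(\mathcal{T})}$ be natural numbers. Suppose that for every $\nu\in\mathrm{int}(\mathcal{T})$ $$\sum_{r=R'_\nu+1}^{R_\nu}\sigma^{(\nu,r)}\le\epsilon\,(|\mathcal{T}|-N)^{-1}\,B^{|C(\nu)|+1-|\mathcal{T}|}$$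 (if $B=0$, a negative power of $B$ is read as $0$). Then there is a tensor $\mathcal{W}\in\mathbb{R}^{D_1,\dots,D_N}$ with $\mathrm{rank}\,[\![\mathcal{W}]\!]_\nu\le R'_{Pa(\nu)}$ for every non-root node $\nu$ and $\|\mathcal{W}_{\mathrm H}-\mathcal{W}\|\le\epsilon$; in particular the infimum of $\|\mathcal{W}_{\mathrm H}-\mathcal{W}\|$ over all tensors $\mathcal{W}$ satisfying these rank bounds is at most $\epsilon$. -/

import Mathlib

universe u

/-- A mode tree over `[N]`: a finite rooted tree (Mathlib's `RootedTree`: the root is `⊥`, the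
parent of a node is `Order.pred`) in which every node is labeled by a subset of `[N]`, the leaves
are exactly the `N` nodes `leaf n` with labels `{n}`, and the label of an interior node is the union
of the labels of its children. The modes `1, …, N` are represented by `Fin N`. -/
structure ModeTree (N : ℕ) where
  tree : RootedTree.{u}
  [fintype : Fintype tree]
  [decidableEq : DecidableEq tree]
  label : tree → Finset (Fin N)
  leaf : Fin N → tree
  label_leaf : ∀ n, label (leaf n) = {n}
  isLeaf_iff : ∀ v : tree, (∀ c : tree, c ≠ ⊥ → Order.pred c ≠ v) ↔ ∃ n, leaf n = v
  label_interior : ∀ v : tree, (∃ c : tree, c ≠ ⊥ ∧ Order.pred c = v) →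
    label v = (Finset.univ.filter fun c : tree => c ≠ ⊥ ∧ Order.pred c = v).biUnion label

attribute [instance] ModeTree.fintype ModeTree.decidableEq

namespace ModeTree

variable {N : ℕ} (T : ModeTree.{u} N)

/-- The nodes of the tree. -/
abbrev Node : Type u := T.tree

/-- The root, whose label is `[N]`. -/
def root : T.Node := ⊥

/-- The parent of a non-root node (its value at the root is never used). -/
def parent (v : T.Node) : T.Node := Order.pred v

/-- The set of children of a node. -/
def children (v : T.Node) : Finset T.Node :=
  Finset.univ.filter fun c => c ≠ T.root ∧ T.parent c = v

/-- Interior nodes are the nodes that have a child; the other ones are leaves. -/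
def IsInterior (v : T.Node) : Prop := (T.children v).Nonempty

theorem mem_children {v c : T.Node} : c ∈ T.children v ↔ c ≠ T.root ∧ T.parent c = v := by
  simp [children]

theorem lt_of_mem_children {v c : T.Node} (h : c ∈ T.children v) : v < c := by
  obtain ⟨h1, h2⟩ := T.mem_children.1 h
  rw [← h2]
  exact Order.pred_lt_of_not_isMin fun hm => h1 hm.eq_bot

theorem label_subset_of_mem_children {v c : T.Node} (h : c ∈ T.children v) :
    T.label c ⊆ T.label v := by
  rw [T.label_interior v ⟨c, T.mem_children.1 h⟩]
  exact Finset.subset_biUnion_of_mem T.label (T.mem_children.2 (T.mem_children.1 h))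

theorem exists_leaf_eq {v : T.Node} (h : ¬ T.IsInterior v) : ∃ n, T.leaf n = v :=
  (T.isLeaf_iff v).1 fun c hc hp => h ⟨c, T.mem_children.2 ⟨hc, hp⟩⟩

/-- The mode `n` of a leaf labeled `{n}`. -/
noncomputable def leafMode {v : T.Node} (h : ¬ T.IsInterior v) : Fin N :=
  Classical.choose (T.exists_leaf_eq h)

theorem leaf_leafMode {v : T.Node} (h : ¬ T.IsInterior v) : T.leaf (T.leafMode h) = v :=
  Classical.choose_spec (T.exists_leaf_eq h)

theorem leafMode_mem {v : T.Node} (h : ¬ T.IsInterior v) : T.leafMode h ∈ T.label v := by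
  have h1 := T.label_leaf (T.leafMode h)
  rw [T.leaf_leafMode h] at h1
  simp [h1]

/-- The dimension `D_n` of the mode `n`. The family `R` gives the number `R_v` of local components
at every interior node `v`, and is extended to the leaves by `R_{{n}} := D_n`. -/
def modeDim (R : T.Node → ℕ) (n : Fin N) : ℕ := R (T.leaf n)

/-- `R_{Pa(v)}`, with the convention `R_{Pa([N])} := 1` at the root. -/
def parentDim (R : T.Node → ℕ) (v : T.Node) : ℕ := if v = T.root then 1 else R (T.parent v)

theorem parentDim_root (R : T.Node → ℕ) : T.parentDim R T.root = 1 := by simp [parentDim]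

theorem parentDim_of_mem_children (R : T.Node → ℕ) {v c : T.Node} (h : c ∈ T.children v) :
    T.parentDim R c = R v := by
  obtain ⟨h1, h2⟩ := T.mem_children.1 h
  simp [parentDim, h1, h2]

/-- Weight matrices `W^{(v)} ∈ ℝ^{R_v, R_{Pa(v)}}`, one for each node `v`. -/
abbrev Weights (R : T.Node → ℕ) : Type u :=
  ∀ v : T.Node, Matrix (Fin (R v)) (Fin (T.parentDim R v)) ℝ

/-- Multi-indices of a tensor whose modes are the elements of `I ⊆ [N]`. Modes are addressed by
name, so no permutation of modes is needed when tensors with disjoint sets of modes are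
multiplied. -/
abbrev Index (R : T.Node → ℕ) (I : Finset (Fin N)) : Type :=
  ∀ i : {n // n ∈ I}, Fin (T.modeDim R i.1)

/-- Tensors in `ℝ^{D_1, …, D_N}`, with the Frobenius norm. -/
abbrev Tensor (R : T.Node → ℕ) : Type :=
  EuclideanSpace ℝ (∀ n : Fin N, Fin (T.modeDim R n))

variable {T} {R : T.Node → ℕ}

/-- For a child `c` of `v`, an element of `[R_v]` viewed as a column index of `W^{(c)}`. -/
def colIdx {v c : T.Node} (h : c ∈ T.children v) (r : Fin (R v)) : Fin (T.parentDim R c) :=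
  Fin.cast (T.parentDim_of_mem_children R h).symm r

/-- A multi-index over the label of `v`, restricted to the label of a child `c`. -/
def restrictIdx {v c : T.Node} (h : c ∈ T.children v) (d : T.Index R (T.label v)) :
    T.Index R (T.label c) :=
  fun i => d ⟨i.1, T.label_subset_of_mem_children h i.2⟩

/-- A multi-index over the label `{n}` of a leaf, viewed as a row index of its weight matrix. -/
noncomputable def leafIdx {v : T.Node} (h : ¬ T.IsInterior v) (d : T.Index R (T.label v)) :
    Fin (R v) :=
  Fin.cast (congrArg R (T.leaf_leafMode h)) (d ⟨T.leafMode h, T.leafMode_mem h⟩)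

open Classical in
/-- The intermediate tensors `𝒲^{(v, r)}`, for `r ∈ [R_{Pa(v)}]`, as functions of the multi-index
`d` over the label of `v`: `𝒲^{(v, r)} = W^{(v)}_{:, r}` at a leaf, and
`𝒲^{(v, r)} = ∑_{r'} W^{(v)}_{r', r} ⨂_{c ∈ C(v)} 𝒲^{(c, r')}` at an interior node. -/
noncomputable def intermediate (W : T.Weights R) (v : T.Node) (r : Fin (T.parentDim R v))
    (d : T.Index R (T.label v)) : ℝ :=
  if h : T.IsInterior v then
    ∑ r' : Fin (R v), W v r' r *
      ∏ c : {c // c ∈ T.children v}, intermediate W c.1 (colIdx c.2 r') (restrictIdx c.2 d)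
  else W v (leafIdx h d) r
termination_by Fintype.card {w : T.Node // v < w}
decreasing_by
  have hc := T.lt_of_mem_children c.2
  exact Fintype.card_lt_of_injective_of_notMem
    (fun w : {w : T.Node // c.1 < w} => (⟨w.1, hc.trans w.2⟩ : {w : T.Node // v < w}))
    (fun a b hab => Subtype.ext (congrArg (fun x : {w : T.Node // v < w} => x.1) hab))
    (b := ⟨c.1, hc⟩) (by rintro ⟨w, hw⟩; exact w.2.ne' (congrArg Subtype.val hw))

/-- The end tensor of the hierarchical tensor factorization. -/
noncomputable def endTensor (W : T.Weights R) : T.Tensor R :=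
  WithLp.toLp 2 fun d =>
    intermediate W T.root (Fin.cast (T.parentDim_root R).symm 0) fun i => d i.1

/-- The `(v, r)`'th local component `W^{(v)}_{r, :} ⊗ (⨂_{c ∈ C(v)} W^{(c)}_{:, r})`. -/
noncomputable def localComponent (W : T.Weights R) (v : T.Node) (r : Fin (R v)) :
    EuclideanSpace ℝ (Fin (T.parentDim R v) × ∀ c : {c // c ∈ T.children v}, Fin (R c.1)) :=
  WithLp.toLp 2 fun p => W v r p.1 * ∏ c : {c // c ∈ T.children v}, W c.1 (p.2 c) (colIdx c.2 r)

/-- The (Frobenius) norm of the `(v, r)`'th local component. -/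
noncomputable def localComponentNorm (W : T.Weights R) (v : T.Node) (r : Fin (R v)) : ℝ :=
  ‖localComponent W v r‖

open scoped Matrix.Norms.Frobenius in
/-- `max_v ‖W^{(v)}‖`, with Frobenius norms. -/
noncomputable def maxWeightNorm (W : T.Weights R) : ℝ :=
  Finset.univ.sup' ⟨T.root, Finset.mem_univ _⟩ fun v => ‖W v‖

/-- The matricization of a tensor with respect to `I ⊆ [N]`: rows correspond to the modes in `I`
and columns to the other modes. -/
def matricize (A : T.Tensor R) (I : Finset (Fin N)) :
    Matrix (T.Index R I) (∀ j : {n // n ∉ I}, Fin (T.modeDim R j.1)) ℝ :=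
  Matrix.of fun a b => A fun n => if h : n ∈ I then a ⟨n, h⟩ else b ⟨n, h⟩

/-- The tensors whose hierarchical tensor rank is at most `(R'_{Pa(v)})_v` element-wise, `v` ranging
over the non-root nodes. -/
def lowRank (T : ModeTree.{u} N) (R : T.Node → ℕ) (R' : T.Node → ℕ) : Set (T.Tensor R) :=
  {A | ∀ v : T.Node, v ≠ T.root → (matricize A (T.label v)).rank ≤ R' (T.parent v)}

end ModeTree

section

open scoped Matrix Matrix.Norms.Frobenius

/-! The approximant is the end tensor of the truncated weights: at every interior node the rows of
index at least `R' v` are set to zero.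

Rank: freeze the modes outside the label of `v`. Only the factor on the path from the root to `v`
still varies, so every column of the matricization is a combination of the intermediate tensors at
`v`. At the parent `p` of `v`, truncation leaves at most `R' p` of them
(`intermediate_truncate_mem_span`).

Error: stack the intermediate tensors at `v` as the rows of a matrix, so that the recursion becomes
`Wᵀ * P`, with `P` the row-wise tensor product over the children. Changing `W` at `v` costs the
removed local component norms times one factor `B` per descendant of `v` that is not a child.
Changing `P` is controlled by multilinearity and the errors at the children. Weighted by `B` to the
number of nodes outside the subtree, the errors simply add up, at most `δ` per interior node
(`norm_interMatrix_sub_truncate_le`); at the root the weight is 1. -/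

theorem Fintype.sum_comp_le_sum_of_injective {α β : Type*} [Fintype α] [Fintype β] {e : α → β}
    (he : Function.Injective e) {f : β → ℝ} (hf : ∀ b, 0 ≤ f b) : ∑ a, f (e a) ≤ ∑ b, f b := by
  classical
  rw [← Finset.sum_image (f := f) (s := Finset.univ) he.injOn]
  exact Finset.sum_le_sum_of_subset_of_nonneg (Finset.subset_univ _) fun b _ _ => hf b

/-! ### Frobenius norms and row-wise tensor products. -/

namespace Matrix

variable {m n k : Type*} [Fintype m] [Fintype n] [Fintype k]

theorem frobenius_norm_sq (A : Matrix m n ℝ) : ‖A‖ ^ 2 = ∑ i, ∑ j, A i j ^ 2 := by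
  have h : (0 : ℝ) ≤ ∑ i, ∑ j, A i j ^ 2 := by positivity
  rw [frobenius_norm_def]
  simp only [Real.rpow_two, Real.norm_eq_abs, sq_abs]
  rw [← Real.sqrt_eq_rpow, Real.sq_sqrt h]

theorem frobenius_norm_submatrix_left_le (A : Matrix m n ℝ) {e : k → m}
    (he : Function.Injective e) : ‖A.submatrix e id‖ ≤ ‖A‖ := by
  refine le_of_sq_le_sq ?_ (norm_nonneg _)
  rw [frobenius_norm_sq, frobenius_norm_sq]
  exact Fintype.sum_comp_le_sum_of_injective he (f := fun i => ∑ j, A i j ^ 2)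
    fun i => by positivity

theorem frobenius_norm_submatrix_right_le (A : Matrix m n ℝ) {e : k → n}
    (he : Function.Injective e) : ‖A.submatrix id e‖ ≤ ‖A‖ := by
  have := frobenius_norm_submatrix_left_le Aᵀ he
  rwa [← transpose_submatrix, frobenius_norm_transpose, frobenius_norm_transpose] at this

end Matrix

/-- The row-wise tensor product of matrices with a common set of rows, the columns of the factors
being obtained from a common column index set. -/
noncomputable def rowTensor {ι κ δ : Type*} [Fintype ι] {χ : ι → Type*} (ρ : ∀ c, δ → χ c) :
    MultilinearMap ℝ (fun c => Matrix κ (χ c) ℝ) (Matrix κ δ ℝ) where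
  toFun x := Matrix.of fun r d => ∏ c, x c r (ρ c d)
  map_update_add' {inst} x i a b := by
    ext r d
    have h (y : Matrix κ (χ i) ℝ) : ∏ c, Function.update x i y c r (ρ c d) =
        y r (ρ i d) * ∏ c ∈ Finset.univ.erase i, x c r (ρ c d) := by
      rw [← Finset.mul_prod_erase _ _ (Finset.mem_univ i), Function.update_self]
      congr 1
      exact Finset.prod_congr rfl fun c hc => by
        rw [Function.update_of_ne (Finset.ne_of_mem_erase hc)]
    simp [h, add_mul]
  map_update_smul' {inst} x i a b := by
    ext r d
    have h (y : Matrix κ (χ i) ℝ) : ∏ c, Function.update x i y c r (ρ c d) =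
        y r (ρ i d) * ∏ c ∈ Finset.univ.erase i, x c r (ρ c d) := by
      rw [← Finset.mul_prod_erase _ _ (Finset.mem_univ i), Function.update_self]
      congr 1
      exact Finset.prod_congr rfl fun c hc => by
        rw [Function.update_of_ne (Finset.ne_of_mem_erase hc)]
    simp [h, mul_assoc]

section rowTensor

variable {ι κ δ : Type*} [Fintype ι] {χ : ι → Type*} (ρ : ∀ c, δ → χ c)

theorem rowTensor_apply (x : ∀ c, Matrix κ (χ c) ℝ) (r : κ) (d : δ) :
    rowTensor ρ x r d = ∏ c, x c r (ρ c d) := rfl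

theorem rowTensor_submatrix {κ' : Type*} (x : ∀ c, Matrix κ (χ c) ℝ) (e : κ' → κ) :
    (rowTensor ρ x).submatrix e id = rowTensor ρ fun c => (x c).submatrix e id := rfl

variable [Fintype κ] [Fintype δ] [∀ c, Fintype (χ c)]

/-- Expanding the product of the squared norms gives a sum over independent choices of an entry in
each factor. The squared norm on the left keeps only choices with a common row and compatible
columns. A nonempty `ι` is what lets the row be recovered from such a choice. -/
theorem norm_rowTensor_le [Nonempty ι] (hρ : Function.Injective fun d c => ρ c d)
    (x : ∀ c, Matrix κ (χ c) ℝ) : ‖rowTensor ρ x‖ ≤ ∏ c, ‖x c‖ := by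
  classical
  refine le_of_sq_le_sq ?_ (Finset.prod_nonneg fun _ _ => norm_nonneg _)
  rw [← Finset.prod_pow, Matrix.frobenius_norm_sq]
  simp only [Matrix.frobenius_norm_sq, rowTensor_apply, ← Finset.prod_pow]
  simp_rw [← Fintype.sum_prod_type']
  rw [Fintype.prod_sum]
  have hinj : Function.Injective fun (q : κ × δ) (c : ι) => (q.1, ρ c q.2) := by
    rintro ⟨r, d⟩ ⟨r', d'⟩ h
    have h' (c : ι) := Prod.ext_iff.1 (congrFun h c)
    exact Prod.ext (h' (Classical.arbitrary ι)).1 (hρ (funext fun c => (h' c).2))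
  exact Fintype.sum_comp_le_sum_of_injective hinj
    (f := fun p : ∀ c, κ × χ c => ∏ c, x c (p c).1 (p c).2 ^ 2)
    fun p => Finset.prod_nonneg fun _ _ => sq_nonneg _

/-- Telescoping: the factors are exchanged one at a time, and multilinearity isolates the difference
in one factor. -/
theorem norm_rowTensor_sub_le [DecidableEq ι] [Nonempty ι]
    (hρ : Function.Injective fun d c => ρ c d) (x y : ∀ c, Matrix κ (χ c) ℝ) {b : ι → ℝ}
    (hx : ∀ c, ‖x c‖ ≤ b c) (hy : ∀ c, ‖y c‖ ≤ b c) :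
    ‖rowTensor ρ x - rowTensor ρ y‖ ≤
      ∑ c, ‖x c - y c‖ * ∏ j ∈ Finset.univ.erase c, b j := by
  refine ((rowTensor ρ).norm_image_sub_le_of_bound' zero_le_one
    (fun m => by simpa using norm_rowTensor_le ρ hρ m) x y).trans ?_
  rw [one_mul]
  refine Finset.sum_le_sum fun c _ => ?_
  rw [← Finset.mul_prod_erase _ _ (Finset.mem_univ c), if_pos rfl]
  refine mul_le_mul_of_nonneg_left (Finset.prod_le_prod ?_ ?_) (norm_nonneg _)
  · intro j hj
    rw [if_neg (Finset.ne_of_mem_erase hj)]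
    positivity
  · intro j hj
    rw [if_neg (Finset.ne_of_mem_erase hj)]
    exact max_le (hx j) (hy j)

end rowTensor

/-! ### Order and counting in mode trees. -/

namespace ModeTree

variable {N : ℕ} (T : ModeTree.{u} N)

theorem exists_mem_children_le {u v : T.Node} (h : u < v) : ∃ c ∈ T.children u, c ≤ v := by
  induction v using WellFoundedLT.induction with
  | ind v ih =>
    have hv : v ≠ T.root := fun h' => not_lt_bot (a := u) (by rw [h'] at h; exact h)
    -- Climb from `v` to its parent until the parent is `u`.
    rcases (Order.le_pred_of_lt h).eq_or_lt with he | hl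
    · exact ⟨v, T.mem_children.2 ⟨hv, he.symm⟩, le_rfl⟩
    · obtain ⟨c, hc, hcv⟩ :=
        ih _ (Order.pred_lt_of_not_isMin fun hm => hv hm.eq_bot) hl
      exact ⟨c, hc, hcv.trans (Order.pred_le v)⟩

theorem isInterior_of_lt {u v : T.Node} (h : u < v) : T.IsInterior u :=
  let ⟨c, hc, _⟩ := T.exists_mem_children_le h
  ⟨c, hc⟩

/-- The ancestors of `w` form a chain, and two distinct comparable siblings are impossible: the
smaller would lie at or above their common parent. Hence sibling subtrees are disjoint. -/
theorem eq_of_mem_children_of_le {u c c' w : T.Node} (hc : c ∈ T.children u)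
    (hc' : c' ∈ T.children u) (h : c ≤ w) (h' : c' ≤ w) : c = c' := by
  have key {a b : T.Node} (ha : a ∈ T.children u) (hb : b ∈ T.children u) (hab : a ≤ b) :
      a = b := by
    by_contra hne
    have h1 : a ≤ T.parent b := Order.le_pred_of_lt (lt_of_le_of_ne hab hne)
    rw [(T.mem_children.1 hb).2] at h1
    exact (T.lt_of_mem_children ha).not_ge h1
  rcases le_total_of_directed h' h with hl | hl
  · exact key hc hc' hl
  · exact (key hc' hc hl).symm

theorem leaf_injective : Function.Injective T.leaf := fun m n h => by
  have := congrArg T.label h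
  rwa [T.label_leaf, T.label_leaf, Finset.singleton_inj] at this

theorem not_isInterior_leaf (n : Fin N) : ¬ T.IsInterior (T.leaf n) := fun ⟨c, hc⟩ =>
  (T.isLeaf_iff _).2 ⟨n, rfl⟩ c (T.mem_children.1 hc).1 (T.mem_children.1 hc).2

theorem label_eq_biUnion {v : T.Node} (hv : T.IsInterior v) :
    label T v = (T.children v).biUnion T.label := by
  obtain ⟨c, hc⟩ := hv
  exact T.label_interior v ⟨c, T.mem_children.1 hc⟩

/-- This turns questions on labels into questions on the tree order; in particular siblings have
disjoint labels and the root carries every mode. -/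
theorem mem_label_iff {n : Fin N} {v : T.Node} : n ∈ T.label v ↔ v ≤ T.leaf n := by
  induction v using WellFoundedGT.induction with
  | ind v ih =>
    by_cases hv : T.IsInterior v
    · rw [T.label_eq_biUnion hv, Finset.mem_biUnion]
      constructor
      · rintro ⟨c, hc, hn⟩
        exact (T.lt_of_mem_children hc).le.trans ((ih c (T.lt_of_mem_children hc)).1 hn)
      · intro h
        have hne : v ≠ T.leaf n := by
          rintro rfl
          exact T.not_isInterior_leaf n hv
        obtain ⟨c, hc, hcn⟩ := T.exists_mem_children_le (lt_of_le_of_ne h hne)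
        exact ⟨c, hc, (ih c (T.lt_of_mem_children hc)).2 hcn⟩
    · obtain ⟨m, rfl⟩ := T.exists_leaf_eq hv
      rw [T.label_leaf, Finset.mem_singleton]
      constructor
      · rintro rfl
        exact le_rfl
      · intro h
        rcases h.eq_or_lt with he | hl
        · exact (T.leaf_injective he).symm
        · exact absurd (T.isInterior_of_lt hl) hv

open Classical in
/-- The number of proper descendants of a node. -/
noncomputable def numDesc (v : T.Node) : ℕ := (Finset.univ.filter fun w => v < w).card

open Classical in
/-- The number of interior nodes in the subtree rooted at a node. -/
noncomputable def numInterior (v : T.Node) : ℕ :=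
  (Finset.univ.filter fun w => v ≤ w ∧ T.IsInterior w).card

open Classical in
theorem filter_lt_eq_biUnion (v : T.Node) (p : T.Node → Prop) :
    (Finset.univ.filter fun w => v < w ∧ p w) =
      (T.children v).biUnion fun c => Finset.univ.filter fun w => c ≤ w ∧ p w := by
  ext w
  simp only [Finset.mem_filter_univ, Finset.mem_biUnion]
  constructor
  · rintro ⟨h, hp⟩
    obtain ⟨c, hc, hcw⟩ := T.exists_mem_children_le h
    exact ⟨c, hc, hcw, hp⟩
  · rintro ⟨c, hc, hcw, hp⟩
    exact ⟨(T.lt_of_mem_children hc).trans_le hcw, hp⟩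

open Classical in
theorem card_filter_lt (v : T.Node) (p : T.Node → Prop) :
    (Finset.univ.filter fun w => v < w ∧ p w).card =
      ∑ c : {c // c ∈ T.children v}, (Finset.univ.filter fun w => c.1 ≤ w ∧ p w).card := by
  rw [filter_lt_eq_biUnion, Finset.card_biUnion, Finset.sum_coe_sort (T.children v)
    (fun c => (Finset.univ.filter fun w => c ≤ w ∧ p w).card)]
  intro c hc c' hc' hne
  refine Finset.disjoint_left.2 fun w hw hw' => ?_
  exact hne (T.eq_of_mem_children_of_le hc hc' (Finset.mem_filter_univ _ |>.1 hw).1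
    (Finset.mem_filter_univ _ |>.1 hw').1)

open Classical in
theorem card_filter_le {v : T.Node} {p : T.Node → Prop} (hv : p v) :
    (Finset.univ.filter fun w => v ≤ w ∧ p w).card =
      (Finset.univ.filter fun w => v < w ∧ p w).card + 1 := by
  rw [← Finset.card_insert_of_notMem (a := v) (by simp)]
  congr 1
  ext w
  simp only [Finset.mem_filter_univ, Finset.mem_insert, le_iff_eq_or_lt]
  constructor
  · rintro ⟨rfl | h, hp⟩
    · exact Or.inl rfl
    · exact Or.inr ⟨h, hp⟩
  · rintro (rfl | ⟨h, hp⟩)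
    · exact ⟨Or.inl rfl, hv⟩
    · exact ⟨Or.inr h, hp⟩

theorem numDesc_eq_sum (v : T.Node) :
    T.numDesc v = ∑ c : {c // c ∈ T.children v}, (T.numDesc c.1 + 1) := by
  classical
  have h := T.card_filter_lt v fun _ => True
  have h' (c : T.Node) := T.card_filter_le (v := c) (p := fun _ => True) trivial
  simp only [h'] at h
  simpa only [numDesc, and_true] using h

theorem numInterior_eq_sum {v : T.Node} (hv : T.IsInterior v) :
    T.numInterior v = ∑ c : {c // c ∈ T.children v}, T.numInterior c.1 + 1 := by
  classical
  rw [numInterior, card_filter_le T hv, card_filter_lt]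
  rfl

theorem numDesc_of_not_isInterior {v : T.Node} (hv : ¬ T.IsInterior v) : T.numDesc v = 0 := by
  classical
  rw [numDesc, Finset.card_eq_zero, Finset.filter_eq_empty_iff]
  exact fun w _ h => hv (T.isInterior_of_lt h)

theorem numDesc_root_add_one : T.numDesc T.root + 1 = Fintype.card T.Node := by
  classical
  have h := T.card_filter_le (v := T.root) (p := fun _ => True) trivial
  have hb (w : T.Node) : T.root ≤ w := bot_le
  simp only [and_true, hb, Finset.filter_true] at h
  exact h.symm

theorem numInterior_root_add : T.numInterior T.root + N = Fintype.card T.Node := by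
  classical
  have hb (w : T.Node) : T.root ≤ w := bot_le
  have h1 : (Finset.univ.filter fun w => ¬ T.IsInterior w) = Finset.univ.image T.leaf := by
    ext w
    simp only [Finset.mem_filter_univ, Finset.mem_image, Finset.mem_univ, true_and]
    constructor
    · exact T.exists_leaf_eq
    · rintro ⟨n, rfl⟩
      exact T.not_isInterior_leaf n
  have h2 : (Finset.univ.filter fun w => ¬ T.IsInterior w).card = N := by
    rw [h1, Finset.card_image_of_injective _ T.leaf_injective, Finset.card_univ, Fintype.card_fin]
  rw [numInterior]
  simp only [hb, true_and]
  rw [← Finset.card_univ, ← Finset.card_filter_add_card_filter_not (s := Finset.univ) T.IsInterior, h2]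

end ModeTree

/-! ### Intermediate tensors as matrices. -/

namespace ModeTree

variable {N : ℕ} {T : ModeTree.{u} N} {R : T.Node → ℕ}

/-- The intermediate tensors at `v` as the rows of a matrix. -/
noncomputable def interMatrix (W : T.Weights R) (v : T.Node) :
    Matrix (Fin (T.parentDim R v)) (T.Index R (T.label v)) ℝ :=
  Matrix.of (intermediate W v)

/-- The tensor products over the children of `v` of their intermediate tensors, as the rows of a
matrix. -/
noncomputable def childTensor (W : T.Weights R) (v : T.Node) :
    Matrix (Fin (R v)) (T.Index R (T.label v)) ℝ :=
  rowTensor (fun c : {c // c ∈ T.children v} => restrictIdx c.2)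
    fun c => (interMatrix W c.1).submatrix (colIdx c.2) id

theorem childTensor_apply (W : T.Weights R) (v : T.Node) (r : Fin (R v))
    (d : T.Index R (T.label v)) : childTensor W v r d =
      ∏ c : {c // c ∈ T.children v}, intermediate W c.1 (colIdx c.2 r) (restrictIdx c.2 d) := rfl

theorem intermediate_of_isInterior (W : T.Weights R) {v : T.Node} (hv : T.IsInterior v)
    (r : Fin (T.parentDim R v)) (d : T.Index R (T.label v)) :
    intermediate W v r d = ∑ r' : Fin (R v), W v r' r * childTensor W v r' d := by
  rw [intermediate, dif_pos hv]
  rfl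

theorem intermediate_of_not_isInterior (W : T.Weights R) {v : T.Node} (hv : ¬ T.IsInterior v)
    (r : Fin (T.parentDim R v)) (d : T.Index R (T.label v)) :
    intermediate W v r d = W v (leafIdx hv d) r := by
  rw [intermediate, dif_neg hv]

theorem interMatrix_of_isInterior (W : T.Weights R) {v : T.Node} (hv : T.IsInterior v) :
    interMatrix W v = (W v)ᵀ * childTensor W v := by
  ext r d
  exact intermediate_of_isInterior W hv r d

theorem interMatrix_of_not_isInterior (W : T.Weights R) {v : T.Node} (hv : ¬ T.IsInterior v) :
    interMatrix W v = (W v)ᵀ.submatrix id (leafIdx hv) := by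
  ext r d
  exact intermediate_of_not_isInterior W hv r d

theorem colIdx_injective {v c : T.Node} (h : c ∈ T.children v) :
    Function.Injective (colIdx (R := R) h) :=
  Fin.cast_injective (T.parentDim_of_mem_children R h).symm

theorem leafIdx_injective {v : T.Node} (hv : ¬ T.IsInterior v) :
    Function.Injective (leafIdx (R := R) hv) := by
  intro d d' h
  have h1 := Fin.cast_injective _ h
  funext i
  have hi : i = ⟨T.leafMode hv, T.leafMode_mem hv⟩ := by
    have h2 := T.label_leaf (T.leafMode hv)
    rw [T.leaf_leafMode hv] at h2
    exact Subtype.ext (Finset.mem_singleton.1 (h2.subset i.2))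
  rw [hi, h1]

theorem restrictIdx_injective {v : T.Node} (hv : T.IsInterior v) :
    Function.Injective fun (d : T.Index R (T.label v)) (c : {c // c ∈ T.children v}) =>
      restrictIdx c.2 d := by
  intro d d' h
  funext ⟨i, hi⟩
  have hi' := hi
  rw [T.label_eq_biUnion hv, Finset.mem_biUnion] at hi'
  obtain ⟨c, hc, hic⟩ := hi'
  exact congrFun (congrFun h ⟨c, hc⟩) ⟨i, hic⟩

theorem nonempty_children {v : T.Node} (hv : T.IsInterior v) :
    Nonempty {c // c ∈ T.children v} := hv.to_subtype

theorem norm_childTensor_submatrix_le (W : T.Weights R) {v : T.Node} (hv : T.IsInterior v)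
    {K : Type} [Fintype K] (e : K → Fin (R v)) :
    ‖(childTensor W v).submatrix e id‖ ≤
      ∏ c : {c // c ∈ T.children v}, ‖(interMatrix W c.1).submatrix (colIdx c.2 ∘ e) id‖ := by
  have := nonempty_children hv
  rw [childTensor, rowTensor_submatrix]
  exact norm_rowTensor_le _ (restrictIdx_injective hv) _

/-! ### Norm bounds for intermediate tensors and local components. -/

section bounds

variable {W : T.Weights R} {B : ℝ}

/-- Submultiplicativity gives one factor `B` per proper descendant. The selection `e` keeps the norm
of only the chosen columns of `W v`; with a single column this is a factor of a local component
norm. -/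
theorem norm_interMatrix_submatrix_le (hB : 0 ≤ B) (hW : ∀ v, ‖W v‖ ≤ B)
    (v : T.Node) {K : Type} [Fintype K]
    (e : K → Fin (T.parentDim R v)) :
    ‖(interMatrix W v).submatrix e id‖ ≤ ‖(W v).submatrix id e‖ * B ^ T.numDesc v := by
  induction v using WellFoundedGT.induction generalizing K with
  | ind v ih =>
    by_cases hv : T.IsInterior v
    · have h1 : (interMatrix W v).submatrix e id =
          ((W v).submatrix id e)ᵀ * childTensor W v := by
        rw [interMatrix_of_isInterior W hv]
        rfl
      rw [h1]
      refine (Matrix.frobenius_norm_mul _ _).trans ?_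
      rw [Matrix.frobenius_norm_transpose]
      refine mul_le_mul_of_nonneg_left ?_ (norm_nonneg _)
      refine (norm_childTensor_submatrix_le W hv id).trans ?_
      rw [numDesc_eq_sum, ← Finset.prod_pow_eq_pow_sum]
      refine Finset.prod_le_prod (fun _ _ => norm_nonneg _) fun c _ => ?_
      refine (ih c.1 (T.lt_of_mem_children c.2) _).trans ?_
      rw [pow_succ']
      gcongr
      exact (Matrix.frobenius_norm_submatrix_right_le _ (colIdx_injective c.2)).trans (hW c.1)
    · rw [numDesc_of_not_isInterior T hv, pow_zero, mul_one, interMatrix_of_not_isInterior W hv]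
      refine (Matrix.frobenius_norm_submatrix_right_le ((W v)ᵀ.submatrix e id)
        (leafIdx_injective hv)).trans ?_
      rw [← Matrix.transpose_submatrix, Matrix.frobenius_norm_transpose]

theorem norm_interMatrix_colIdx_le (hB : 0 ≤ B) (hW : ∀ v, ‖W v‖ ≤ B)
    {v c : T.Node} (hc : c ∈ T.children v) :
    ‖(interMatrix W c).submatrix (colIdx hc) id‖ ≤ B ^ (T.numDesc c + 1) := by
  refine (norm_interMatrix_submatrix_le hB hW c _).trans ?_
  rw [pow_succ']
  gcongr
  exact (Matrix.frobenius_norm_submatrix_right_le _ (colIdx_injective hc)).trans (hW c)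

end bounds

/-- The norm of a tensor product is the product of the norms. Rows and columns appear as submatrices
indexed by `Unit` to match the matrix estimates. -/
theorem localComponentNorm_eq (W : T.Weights R) (v : T.Node) (r : Fin (R v)) :
    localComponentNorm W v r = ‖(W v).submatrix (fun _ : Unit => r) id‖ *
      ∏ c : {c // c ∈ T.children v}, ‖(W c.1).submatrix id (fun _ : Unit => colIdx c.2 r)‖ := by
  rw [localComponentNorm]
  refine (sq_eq_sq₀ (norm_nonneg _) (by positivity)).1 ?_
  rw [mul_pow, ← Finset.prod_pow, EuclideanSpace.norm_sq_eq]
  simp only [Matrix.frobenius_norm_sq, Matrix.submatrix_apply, id, Finset.univ_unique,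
    Finset.sum_singleton]
  rw [Fintype.prod_sum, Finset.sum_mul_sum, Fintype.sum_prod_type]
  simp only [localComponent, Real.norm_eq_abs, sq_abs, mul_pow, Finset.prod_pow]

/-- The weights with the local components of index at least `R' v` removed at every interior node
`v`. -/
noncomputable def truncate (W : T.Weights R) (R' : T.Node → ℕ) : T.Weights R :=
  open Classical in
  fun v => Matrix.of fun r s => if T.IsInterior v ∧ R' v ≤ r.val then 0 else W v r s

theorem truncate_of_not_isInterior (W : T.Weights R) (R' : T.Node → ℕ) {v : T.Node}
    (hv : ¬ T.IsInterior v) : truncate W R' v = W v := by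
  ext r s
  simp [truncate, hv]

theorem truncate_apply (W : T.Weights R) (R' : T.Node → ℕ) {v : T.Node}
    (hv : T.IsInterior v) (r : Fin (R v)) (s : Fin (T.parentDim R v)) :
    truncate W R' v r s = if R' v ≤ r.val then 0 else W v r s := by
  simp [truncate, hv]

theorem norm_truncate_le (W : T.Weights R) (R' : T.Node → ℕ) (v : T.Node) :
    ‖truncate W R' v‖ ≤ ‖W v‖ := by
  refine le_of_sq_le_sq ?_ (norm_nonneg _)
  rw [Matrix.frobenius_norm_sq, Matrix.frobenius_norm_sq]
  refine Finset.sum_le_sum fun r _ => Finset.sum_le_sum fun s _ => ?_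
  simp only [truncate, Matrix.of_apply]
  split_ifs
  · rw [sq, zero_mul]
    exact sq_nonneg _
  · exact le_rfl

/-! ### The error caused by truncation. -/

section truncation

variable {W : T.Weights R} (R' : T.Node → ℕ) {B : ℝ}

/-- Only removed rows survive in the difference, so the product is a sum of outer products, one per
removed local component. -/
theorem sub_truncate_transpose_mul {v : T.Node} (hv : T.IsInterior v) {δ : Type*}
    (P : Matrix (Fin (R v)) δ ℝ) :
    (W v - truncate W R' v)ᵀ * P = ∑ r : Fin (R v) with R' v ≤ r.val,
      ((W v).submatrix (fun _ : Unit => r) id)ᵀ * P.submatrix (fun _ : Unit => r) id := by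
  ext s d
  rw [Matrix.sum_apply, Finset.sum_filter, Matrix.mul_apply]
  refine Finset.sum_congr rfl fun r _ => ?_
  rw [Matrix.transpose_apply, Matrix.sub_apply, truncate_apply W R' hv]
  split_ifs <;> simp [Matrix.mul_apply]

theorem norm_sub_truncate_transpose_mul_le (hB : 0 ≤ B) (hW : ∀ v, ‖W v‖ ≤ B)
    {v : T.Node} (hv : T.IsInterior v) :
    ‖(W v - truncate W R' v)ᵀ * childTensor W v‖ ≤
      (∑ r : Fin (R v) with R' v ≤ r.val, localComponentNorm W v r) *
        B ^ ∑ c : {c // c ∈ T.children v}, T.numDesc c.1 := by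
  rw [sub_truncate_transpose_mul R' hv, Finset.sum_mul]
  refine (norm_sum_le _ _).trans (Finset.sum_le_sum fun r _ => ?_)
  refine (Matrix.frobenius_norm_mul _ _).trans ?_
  rw [Matrix.frobenius_norm_transpose, localComponentNorm_eq, mul_assoc,
    ← Finset.prod_pow_eq_pow_sum, ← Finset.prod_mul_distrib]
  refine mul_le_mul_of_nonneg_left ?_ (norm_nonneg _)
  refine (norm_childTensor_submatrix_le W hv _).trans ?_
  exact Finset.prod_le_prod (fun _ _ => norm_nonneg _)
    fun c _ => norm_interMatrix_submatrix_le hB hW c.1 _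

/-- Here `q` counts the nodes outside the subtree of `v`. Multiplying by `B ^ q` rather than
dividing by powers of `B` also covers `B = 0`. -/
theorem norm_interMatrix_sub_truncate_le (hB : 0 ≤ B) (hW : ∀ v, ‖W v‖ ≤ B)
    {δ : ℝ} (hδ : 0 ≤ δ)
    (h : ∀ v, T.IsInterior v → ∀ j : ℕ, j + 1 + (T.children v).card = Fintype.card T.Node →
      (∑ r : Fin (R v) with R' v ≤ r.val, localComponentNorm W v r) * B ^ j ≤ δ)
    (v : T.Node) (q : ℕ) (hq : q + (T.numDesc v + 1) = Fintype.card T.Node) :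
    ‖interMatrix W v - interMatrix (truncate W R') v‖ * B ^ q ≤ T.numInterior v * δ := by
  classical
  induction v using WellFoundedGT.induction generalizing q with
  | ind v ih =>
    by_cases hv : T.IsInterior v
    · have hW' (w : T.Node) : ‖truncate W R' w‖ ≤ B := (norm_truncate_le W R' w).trans (hW w)
      have hne := nonempty_children hv
      have hdesc := T.numDesc_eq_sum v
      -- The first term keeps the original child tensors, so the local component norms of `W` itself
      -- appear.
      have hsplit : interMatrix W v - interMatrix (truncate W R') v =
          (W v - truncate W R' v)ᵀ * childTensor W v +
            (truncate W R' v)ᵀ * (childTensor W v - childTensor (truncate W R') v) := by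
        rw [interMatrix_of_isInterior _ hv, interMatrix_of_isInterior _ hv, Matrix.transpose_sub,
          Matrix.sub_mul, Matrix.mul_sub]
        abel
      have h1 : ‖(W v - truncate W R' v)ᵀ * childTensor W v‖ * B ^ q ≤ δ := by
        refine (mul_le_mul_of_nonneg_right (norm_sub_truncate_transpose_mul_le R' hB hW hv)
          (by positivity)).trans ?_
        rw [mul_assoc, ← pow_add]
        refine h v hv _ ?_
        rw [← hq, hdesc, Finset.sum_add_distrib]
        simp
        ring
      have h2 : ‖(truncate W R' v)ᵀ * (childTensor W v - childTensor (truncate W R') v)‖ * B ^ q ≤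
          ∑ c : {c // c ∈ T.children v}, T.numInterior c.1 * δ := by
        have h3 := norm_rowTensor_sub_le
          (fun c : {c // c ∈ T.children v} => restrictIdx (R := R) c.2)
          (restrictIdx_injective hv)
          (fun c => (interMatrix W c.1).submatrix (colIdx c.2) id)
          (fun c => (interMatrix (truncate W R') c.1).submatrix (colIdx c.2) id)
          (fun c => norm_interMatrix_colIdx_le hB hW c.2)
          (fun c => norm_interMatrix_colIdx_le hB hW' c.2)
        have h4 : ‖(truncate W R' v)ᵀ *
            (childTensor W v - childTensor (truncate W R') v)‖ ≤ B * _ :=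
          (Matrix.frobenius_norm_mul _ _).trans (mul_le_mul
            ((Matrix.frobenius_norm_transpose _).trans_le (hW' v)) h3 (norm_nonneg _) hB)
        refine (mul_le_mul_of_nonneg_right h4 (by positivity)).trans ?_
        rw [Finset.mul_sum, Finset.sum_mul]
        refine Finset.sum_le_sum fun c _ => ?_
        have h5 : ‖(interMatrix W c.1).submatrix (colIdx c.2) id -
              (interMatrix (truncate W R') c.1).submatrix (colIdx c.2) id‖ ≤
            ‖interMatrix W c.1 - interMatrix (truncate W R') c.1‖ :=
          Matrix.frobenius_norm_submatrix_left_le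
            (interMatrix W c.1 - interMatrix (truncate W R') c.1) (colIdx_injective c.2)
        rw [Finset.prod_pow_eq_pow_sum]
        -- The nodes outside the subtree of `c` are `v`, the subtrees of the siblings of `c`, and
        -- the `q` nodes outside the subtree of `v`.
        refine le_trans ?_ (ih c.1 (T.lt_of_mem_children c.2)
          (1 + ∑ j ∈ Finset.univ.erase c, (T.numDesc j.1 + 1) + q) ?_)
        · rw [pow_add, pow_add, pow_one]
          calc _ = ‖(interMatrix W c.1).submatrix (colIdx c.2) id -
              (interMatrix (truncate W R') c.1).submatrix (colIdx c.2) id‖ *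
                (B * B ^ (∑ j ∈ Finset.univ.erase c, (T.numDesc j.1 + 1)) * B ^ q) := by ring
            _ ≤ _ := mul_le_mul_of_nonneg_right h5 (by positivity)
        · rw [← hq, hdesc, ← Finset.add_sum_erase _ _ (Finset.mem_univ c)]
          ring
      rw [hsplit, T.numInterior_eq_sum hv]
      push_cast
      rw [add_mul, one_mul, Finset.sum_mul, add_comm _ δ]
      refine (mul_le_mul_of_nonneg_right (norm_add_le _ _) (by positivity)).trans ?_
      rw [add_mul]
      exact add_le_add h1 h2
    · rw [interMatrix_of_not_isInterior _ hv, interMatrix_of_not_isInterior _ hv,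
        truncate_of_not_isInterior W R' hv, sub_self, norm_zero, zero_mul]
      positivity

end truncation

/-! ### Rank bounds for the truncated end tensor. -/

/-- As a function of the modes in the label of `v` alone, an intermediate tensor of the truncated
weights at an ancestor `u` of `v` is a combination of the intermediate tensors at `v` that are kept
by the truncation at the parent of `v`. -/
theorem intermediate_truncate_mem_span (W : T.Weights R) (R' : T.Node → ℕ) {p v : T.Node}
    (hv : v ∈ T.children p) {u : T.Node} (huv : u < v) (s : Fin (T.parentDim R u))
    (g : T.Index R (T.label v) → T.Index R (T.label u))
    (hg : ∀ a i (h : i.1 ∈ T.label v), g a i = a ⟨i.1, h⟩)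
    (hg' : ∀ a a' i, i.1 ∉ T.label v → g a i = g a' i) :
    (fun a => intermediate (truncate W R') u s (g a)) ∈
      Submodule.span ℝ (Set.range fun r : {r : Fin (R p) // r.val < R' p} =>
        intermediate (truncate W R') v (colIdx hv r.1)) := by
  classical
  induction u using WellFoundedGT.induction with
  | ind u ih =>
    -- If a mode in the label of `v` has dimension 0, there is no base point `a₀`, but every
    -- function is zero.
    rcases isEmpty_or_nonempty (T.Index R (T.label v)) with hemp | ⟨⟨a₀⟩⟩
    · convert Submodule.zero_mem _
    have hu := T.isInterior_of_lt huv
    obtain ⟨c₀, hc₀, hc₀v⟩ := T.exists_mem_children_le huv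
    set x := truncate W R' with hx
    -- Children of `u` off the path to `v` share no mode with `v`, so their factors are scalars
    -- independent of `a`.
    have hconst (c : {c // c ∈ T.children u}) (hc : c ≠ ⟨c₀, hc₀⟩) (a) :
        restrictIdx c.2 (g a) = restrictIdx c.2 (g a₀) := by
      funext i
      refine hg' _ _ _ fun hi => hc (Subtype.ext ?_)
      exact T.eq_of_mem_children_of_le c.2 hc₀ (T.mem_label_iff.1 i.2)
        (hc₀v.trans (T.mem_label_iff.1 hi))
    have hsum : (fun a => intermediate x u s (g a)) = ∑ r : Fin (R u),
        (x u r s * ∏ c ∈ Finset.univ.erase (⟨c₀, hc₀⟩ : {c // c ∈ T.children u}),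
          intermediate x c.1 (colIdx c.2 r) (restrictIdx c.2 (g a₀))) •
        fun a => intermediate x c₀ (colIdx hc₀ r) (restrictIdx hc₀ (g a)) := by
      funext a
      rw [intermediate_of_isInterior x hu, Finset.sum_apply]
      refine Finset.sum_congr rfl fun r _ => ?_
      rw [childTensor_apply, ← Finset.mul_prod_erase _ _ (Finset.mem_univ ⟨c₀, hc₀⟩),
        Pi.smul_apply, smul_eq_mul, Finset.prod_congr rfl fun c hc => by
          rw [hconst c (Finset.ne_of_mem_erase hc) a]]
      ring
    rw [hsum]
    refine Submodule.sum_mem _ fun r _ => ?_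
    rcases hc₀v.eq_or_lt with rfl | hlt
    · obtain rfl : u = p := (T.mem_children.1 hc₀).2.symm.trans (T.mem_children.1 hv).2
      -- The path has reached the parent of `v`: here the truncation kills the coefficients of index
      -- at least `R' u`.
      by_cases hr : R' u ≤ r.val
      · rw [hx, truncate_apply W R' hu, if_pos hr, zero_mul, zero_smul]
        exact Submodule.zero_mem _
      · refine Submodule.smul_mem _ _ (Submodule.subset_span ⟨⟨r, not_le.1 hr⟩, ?_⟩)
        funext a
        exact congrArg (intermediate x c₀ _) (funext fun i => (hg a ⟨i.1, _⟩ i.2).symm)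
    · exact Submodule.smul_mem _ _ (ih c₀ (T.lt_of_mem_children hc₀) hlt (colIdx hc₀ r)
        (fun a => restrictIdx hc₀ (g a)) (fun a i h => hg a ⟨i.1, _⟩ h)
        (fun a a' i h => hg' a a' ⟨i.1, _⟩ h))

theorem rank_matricize_endTensor_truncate_le (W : T.Weights R) (R' : T.Node → ℕ) {p v : T.Node}
    (hv : v ∈ T.children p) :
    (matricize (endTensor (truncate W R')) (T.label v)).rank ≤ R' p := by
  rw [Matrix.rank_eq_finrank_span_cols]
  have hle : Submodule.span ℝ (Set.range
      (matricize (endTensor (truncate W R')) (T.label v)).col) ≤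
      Submodule.span ℝ (Set.range fun r : {r : Fin (R p) // r.val < R' p} =>
        intermediate (truncate W R') v (colIdx hv r.1)) := by
    rw [Submodule.span_le]
    rintro _ ⟨b, rfl⟩
    have hroot : T.root < v := bot_lt_iff_ne_bot.2 (T.mem_children.1 hv).1
    exact intermediate_truncate_mem_span W R' hv hroot _
      -- The column index `b` supplies the frozen modes.
      (fun a i => if h : i.1 ∈ T.label v then a ⟨i.1, h⟩ else b ⟨i.1, h⟩)
      (fun a i h => dif_pos h) (fun a a' i h => by rw [dif_neg h, dif_neg h])
  refine (Submodule.finrank_mono hle).trans ((finrank_range_le_card _).trans ?_)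
  calc _ ≤ Fintype.card (Fin (R' p)) :=
        Fintype.card_le_of_injective (fun r => ⟨r.1.1, r.2⟩) fun r r' h =>
          Subtype.ext (Fin.ext (Fin.mk.inj h))
    _ = _ := Fintype.card_fin _

theorem endTensor_truncate_mem_lowRank (W : T.Weights R) (R' : T.Node → ℕ) :
    endTensor (truncate W R') ∈ lowRank T R R' := fun _ hv =>
  rank_matricize_endTensor_truncate_le W R' (T.mem_children.2 ⟨hv, rfl⟩)

/-! ### From the root matrix to the end tensor. -/

theorem norm_endTensor_sub_le (W W' : T.Weights R) :
    ‖endTensor W - endTensor W'‖ ≤ ‖interMatrix W T.root - interMatrix W' T.root‖ := by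
  refine le_of_sq_le_sq ?_ (norm_nonneg _)
  rw [EuclideanSpace.norm_sq_eq, Matrix.frobenius_norm_sq]
  refine le_trans ?_ (Finset.single_le_sum
    (f := fun i => ∑ j, (interMatrix W T.root - interMatrix W' T.root) i j ^ 2)
    (fun i _ => by positivity) (Finset.mem_univ (Fin.cast (T.parentDim_root R).symm 0)))
  have hinj : Function.Injective
      fun (d : ∀ n : Fin N, Fin (T.modeDim R n)) (i : {n // n ∈ T.label T.root}) => d i.1 := by
    intro d d' h
    funext n
    exact congrFun h ⟨n, T.mem_label_iff.2 bot_le⟩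
  refine le_trans (le_of_eq ?_) (Fintype.sum_comp_le_sum_of_injective hinj fun j => sq_nonneg _)
  refine Finset.sum_congr rfl fun d _ => ?_
  rw [Real.norm_eq_abs, sq_abs]
  rfl

theorem norm_le_maxWeightNorm (W : T.Weights R) (v : T.Node) : ‖W v‖ ≤ maxWeightNorm W :=
  Finset.le_sup' (fun v => ‖W v‖) (Finset.mem_univ v)

theorem norm_endTensor_sub_truncate_le {W : T.Weights R} (R' : T.Node → ℕ) {B ε : ℝ} (hB : 0 ≤ B)
    (hW : ∀ v, ‖W v‖ ≤ B) (hε : 0 ≤ ε)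
    (h : ∀ v : T.Node, T.IsInterior v →
      ∑ r : Fin (R v) with R' v ≤ r.val, localComponentNorm W v r ≤
        ε * (T.numInterior T.root : ℝ)⁻¹ *
          B ^ (((T.children v).card : ℤ) + 1 - (Fintype.card T.Node : ℤ))) :
    ‖endTensor W - endTensor (truncate W R')‖ ≤ ε := by
  have hδ : 0 ≤ ε * (T.numInterior T.root : ℝ)⁻¹ := by positivity
  have hbound (v : T.Node) (hv : T.IsInterior v) (j : ℕ)
      (hj : j + 1 + (T.children v).card = Fintype.card T.Node) :
      (∑ r : Fin (R v) with R' v ≤ r.val, localComponentNorm W v r) * B ^ j ≤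
        ε * (T.numInterior T.root : ℝ)⁻¹ := by
    refine (mul_le_mul_of_nonneg_right (h v hv) (pow_nonneg hB j)).trans ?_
    have hz : ((T.children v).card : ℤ) + 1 - (Fintype.card T.Node : ℤ) = -(j : ℤ) := by
      rw [← hj]
      push_cast
      ring
    rw [hz, zpow_neg, zpow_natCast, mul_assoc]
    -- If `B = 0`, the product of `B ^ j` and its inverse is 1 for `j = 0` and 0 otherwise, so the
    -- bound by 1 persists.
    exact mul_le_of_le_one_right hδ (inv_mul_le_one (a := B ^ j))
  have hmain := norm_interMatrix_sub_truncate_le R' hB hW hδ hbound T.root 0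
    (by rw [zero_add, T.numDesc_root_add_one])
  rw [pow_zero, mul_one] at hmain
  refine (norm_endTensor_sub_le _ _).trans (hmain.trans ?_)
  rw [mul_left_comm]
  -- The inequality, unlike equality with 1, also holds when there are no interior nodes.
  exact mul_le_of_le_one_right hε mul_inv_le_one

theorem maxWeightNorm_nonneg (W : T.Weights R) : 0 ≤ maxWeightNorm W :=
  (norm_nonneg _).trans (norm_le_maxWeightNorm W T.root)

theorem card_node_sub (T : ModeTree.{u} N) :
    (Fintype.card T.Node : ℝ) - (N : ℝ) = T.numInterior T.root := by
  rw [← T.numInterior_root_add]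
  push_cast
  ring

end ModeTree

end

theorem iInf_norm_sub_le {E : Type*} [SeminormedAddCommGroup E] {s : Set E} {a : E} (ha : a ∈ s)
    (x : E) : ⨅ b : s, ‖x - b.1‖ ≤ ‖x - a‖ :=
  ciInf_le (f := fun b : s => ‖x - b.1‖) ⟨0, by rintro _ ⟨b, rfl⟩; exact norm_nonneg _⟩ ⟨a, ha⟩

theorem proposition2 {N : ℕ} (T : ModeTree.{u} N) (R : T.Node → ℕ) (W : T.Weights R)
    (ε : ℝ) (hε : 0 ≤ ε) (R' : T.Node → ℕ)
    (h : ∀ v : T.Node, T.IsInterior v →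
      ∑ r : Fin (R v) with R' v ≤ r.val, ModeTree.localComponentNorm W v r ≤
        ε * ((Fintype.card T.Node : ℝ) - (N : ℝ))⁻¹ *
          ModeTree.maxWeightNorm W ^
            (((T.children v).card : ℤ) + 1 - (Fintype.card T.Node : ℤ))) :
    (∃ A ∈ ModeTree.lowRank T R R', ‖ModeTree.endTensor W - A‖ ≤ ε) ∧
      (⨅ A : ModeTree.lowRank T R R', ‖ModeTree.endTensor W - A.1‖) ≤ ε := by
  have hA : ‖ModeTree.endTensor W - ModeTree.endTensor (ModeTree.truncate W R')‖ ≤ ε :=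
    ModeTree.norm_endTensor_sub_truncate_le R' (ModeTree.maxWeightNorm_nonneg W)
      (ModeTree.norm_le_maxWeightNorm W) hε fun v hv => T.card_node_sub ▸ h v hv
  have hmem := ModeTree.endTensor_truncate_mem_lowRank W R'
  exact ⟨⟨_, hmem, hA⟩, (iInf_norm_sub_le hmem _).trans hA⟩
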